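/- Let $M$ be a smooth Hausdorff manifold (without boundary, of dimension $n\ge 1$). A Lorentzian metric on $M$ is a smooth symmetric $(2,0)$-tensor $g$ of signature $(-,+,\dots,+)$. A tangent vector $v$ is called timelike if $g(v,v)<0$ and causal if $g(v,v)\le 0$ (so the zero vector is causal). A spacetime $(M,g)$ is a Lorentzian manifold with a time orientation, given by a continuous everywhere timelike vector field $T$; a causal vector $v$ is future directed if $g(v,T)\le 0$. A future directed causal curve is a locally Lipschitz curve $\gamma:J\to M$, $J\subset\mathbb R$ an interval, whose velocity is causal and future directed at almost every time; a past directed one is a future directed one run backwards; a causal curve is a future or past directed causal curve. $(M,g)$ is causal if there is no closed causal curve, i.e. no non-constant causal curve $\gamma:[a,b]\to M$ with $\gamma(a)=\gamma(b)$. For Lorentzian metrics $g,g'$ on $M$ write $g\prec g'$ if every non-zero causal vector for $g$ is timelike for $g'$; then $T$ is also timelike for $g'$ and time-orients it. $(M,g)$ is stably causal if there is a Lorentzian metric $g'$ on $M$ with $g\prec g'$ such that $(M,g')$ is causal. A set $U\subset M$ is causally convex if for every causal curve $\gamma:J\to M$ the set $\{t\in J:\gamma(t)\in U\}$ is connected (possibly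 empty). $(M,g)$ is strongly causal if every point $p\in M$ has arbitrarily small causally convex neighbourhoods, i.e. every neighbourhood of $p$ contains a causally convex neighbourhood of $p$. Proposition. Every stably causal spacetime is strongly causal. -/

import Mathlib

open scoped Manifold ContDiff Topology NNReal
open MeasureTheory

noncomputable section

/-- A Lorentzian metric on a manifold `M` of dimension `d + 1`: a smooth field of symmetric bilinear
forms on the tangent spaces, each of signature `(-, +, …, +)`, i.e. each diagonal with entries
`-1, 1, …, 1` in some basis.  (On a nonempty manifold of dimension `0` there is no such field.) -/
structure LorentzMetric (d : ℕ) (M : Type*) [TopologicalSpace M]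
    [ChartedSpace (EuclideanSpace ℝ (Fin (d + 1))) M] [IsManifold (𝓡 (d + 1)) ∞ M] where
  form (x : M) : TangentSpace (𝓡 (d + 1)) x →L[ℝ] TangentSpace (𝓡 (d + 1)) x →L[ℝ] ℝ
  symm (x : M) (v w : TangentSpace (𝓡 (d + 1)) x) : form x v w = form x w v
  signature (x : M) : ∃ b : Module.Basis (Fin (d + 1)) ℝ (TangentSpace (𝓡 (d + 1)) x),
    ∀ i j, form x (b i) (b j) = if i = j then (if i = 0 then -1 else 1) else 0
  contMDiff : ContMDiff (𝓡 (d + 1))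
    ((𝓡 (d + 1)).prod 𝓘(ℝ, EuclideanSpace ℝ (Fin (d + 1)) →L[ℝ]
      EuclideanSpace ℝ (Fin (d + 1)) →L[ℝ] ℝ)) ∞
    (fun x ↦ Bundle.TotalSpace.mk' (EuclideanSpace ℝ (Fin (d + 1)) →L[ℝ]
      EuclideanSpace ℝ (Fin (d + 1)) →L[ℝ] ℝ)
      (E := fun x : M ↦ TangentSpace (𝓡 (d + 1)) x →L[ℝ] TangentSpace (𝓡 (d + 1)) x →L[ℝ] ℝ)
      x (form x))

namespace LorentzMetric

variable {d : ℕ} {M : Type*} [TopologicalSpace M]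
  [ChartedSpace (EuclideanSpace ℝ (Fin (d + 1))) M] [IsManifold (𝓡 (d + 1)) ∞ M]

/-- A tangent vector is timelike if `g(v, v) < 0`. -/
def IsTimelike (g : LorentzMetric d M) {x : M} (v : TangentSpace (𝓡 (d + 1)) x) : Prop :=
  g.form x v v < 0

/-- A tangent vector is causal if `g(v, v) ≤ 0`; the zero vector is causal. -/
def IsCausalVector (g : LorentzMetric d M) {x : M} (v : TangentSpace (𝓡 (d + 1)) x) : Prop :=
  g.form x v v ≤ 0

/-- A time orientation, given by a representative: a continuous everywhere timelike vector field.
Two representatives `T`, `T'` of the same time orientation, i.e. with `g(T, T') < 0` everywhere,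
give the same future directed causal vectors. -/
structure TimeOrientation (g : LorentzMetric d M) where
  field (x : M) : TangentSpace (𝓡 (d + 1)) x
  continuous_field : Continuous (fun x ↦ (⟨x, field x⟩ : TangentBundle (𝓡 (d + 1)) M))
  timelike_field (x : M) : g.IsTimelike (field x)

/-- `g ≺ g'`: every nonzero `g`-causal vector is `g'`-timelike. -/
def Prec (g g' : LorentzMetric d M) : Prop :=
  ∀ (x : M) (v : TangentSpace (𝓡 (d + 1)) x), v ≠ 0 → g.IsCausalVector v → g'.IsTimelike v

/-- If `g ≺ g'`, a time orientation of `g` is also one of `g'`, given by the same vector field. -/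
def TimeOrientation.ofPrec {g g' : LorentzMetric d M} (τ : g.TimeOrientation) (h : g.Prec g') :
    g'.TimeOrientation where
  field := τ.field
  continuous_field := τ.continuous_field
  timelike_field x := by
    refine h x _ (fun h0 ↦ ?_) (le_of_lt (τ.timelike_field x))
    have h1 := τ.timelike_field x
    simp [IsTimelike, h0] at h1

/-- A causal vector `v` is future directed if `g(v, T) ≤ 0`. -/
def IsFutureCausalVector (g : LorentzMetric d M) (τ : g.TimeOrientation) {x : M}
    (v : TangentSpace (𝓡 (d + 1)) x) : Prop :=
  g.IsCausalVector v ∧ g.form x v (τ.field x) ≤ 0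

/-- `γ` is a future directed causal curve on the interval `J`: it is locally Lipschitz (in charts)
and at almost every time of `J` it has a velocity which is causal and future directed.
The values of `γ` outside `J` are irrelevant. -/
structure IsFutureCurve (g : LorentzMetric d M) (τ : g.TimeOrientation) (γ : ℝ → M)
    (J : Set ℝ) : Prop where
  ordConnected : J.OrdConnected
  continuousOn : ContinuousOn γ J
  lipschitz : ∀ t ∈ J, ∃ K : ℝ≥0, ∃ s ∈ 𝓝[J] t,
    LipschitzOnWith K (fun u ↦ extChartAt (𝓡 (d + 1)) (γ t) (γ u)) s
  velocity : ∀ᵐ t : ℝ, t ∈ J → ∃ v : TangentSpace (𝓡 (d + 1)) (γ t),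
    HasMFDerivWithinAt 𝓘(ℝ, ℝ) (𝓡 (d + 1)) γ J t ((1 : ℝ →L[ℝ] ℝ).smulRight v) ∧
      g.IsFutureCausalVector τ v

/-- A curve is past directed if the same curve run backwards is future directed. -/
def IsPastCurve (g : LorentzMetric d M) (τ : g.TimeOrientation) (γ : ℝ → M)
    (J : Set ℝ) : Prop :=
  g.IsFutureCurve τ (fun t ↦ γ (-t)) {t | -t ∈ J}

/-- A causal curve is a future directed or past directed one. -/
def IsCausalCurve (g : LorentzMetric d M) (τ : g.TimeOrientation) (γ : ℝ → M)
    (J : Set ℝ) : Prop :=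
  g.IsFutureCurve τ γ J ∨ g.IsPastCurve τ γ J

/-- A spacetime is causal if it has no closed causal curve.  Since the zero vector is causal,
constant curves are causal curves, and they do not count as closed causal curves. -/
def IsCausal (g : LorentzMetric d M) (τ : g.TimeOrientation) : Prop :=
  ¬ ∃ (γ : ℝ → M) (a b : ℝ), a < b ∧ g.IsCausalCurve τ γ (Set.Icc a b) ∧ γ a = γ b ∧
    ∃ t ∈ Set.Icc a b, γ t ≠ γ a

/-- A set is causally convex if its intersection with any causal curve is connected (possibly
empty), i.e. the times at which the curve is in the set form an interval. -/
def IsCausallyConvex (g : LorentzMetric d M) (τ : g.TimeOrientation) (U : Set M) : Prop :=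
  ∀ (γ : ℝ → M) (J : Set ℝ), g.IsCausalCurve τ γ J → IsPreconnected {t | t ∈ J ∧ γ t ∈ U}

/-- A spacetime is strongly causal if every point has arbitrarily small causally convex
neighbourhoods. -/
def IsStronglyCausal (g : LorentzMetric d M) (τ : g.TimeOrientation) : Prop :=
  ∀ p : M, ∀ V ∈ 𝓝 p, ∃ U ∈ 𝓝 p, U ⊆ V ∧ g.IsCausallyConvex τ U

/-- A spacetime is stably causal if some Lorentzian metric `g' ≻ g` is causal. -/
def IsStablyCausal (g : LorentzMetric d M) (τ : g.TimeOrientation) : Prop :=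
  ∃ (g' : LorentzMetric d M) (h : g.Prec g'), g'.IsCausal (τ.ofPrec h)

end LorentzMetric

end

/-! Let `g'` be a causal metric with `g ≺ g'`. Given `p` and `V`, take the causally convex hull of a
small neighbourhood `W` of `p`: all points lying on `g`-causal curves between points of `W`. It is
always causally convex, so only its containment in `V` is at stake. Suppose `w₁ ≤ x ≤ w₂` for `g`
with `w₁`, `w₂` in `W` but `x` outside `V`. The curve from `w₁` to `x` leaves a coordinate ball
around `p` at some `z₁ ≠ p`. Near `p` a fixed closed convex cone `C` fits between the cones of `g`
and `g'` (`exists_intermediate_cone`), and the coordinate displacement from `w₁` to `z₁` lies in `C`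
(`sub_mem_cone`). As `w₁` is much closer to `p` than `z₁` is, the displacement from `p` to `z₁` is
still `g'`-causal, and the straight segment gives `p ≤ z₁` for `g'` (`exists_nhds_exit`). The time
reversed argument gives `z₂ ≤ p` for `g'` with `x ≤ z₂`. Then `p ≤ z₁ ≤ x ≤ z₂ ≤ p` is a
non-constant closed `g'`-causal curve, a contradiction. -/

/-! ### Linear algebra of Lorentzian forms -/

section LinearAlgebra

variable {V : Type*} [AddCommGroup V] [Module ℝ V] [TopologicalSpace V]

/-- A symmetric bilinear form which is positive definite on the orthogonal complement of each of
its timelike vectors. -/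
def IsLorentzForm (B : V →L[ℝ] V →L[ℝ] ℝ) : Prop :=
  (∀ v w, B v w = B w v) ∧ ∀ T v, B T T < 0 → B v T = 0 → v ≠ 0 → 0 < B v v

/-- The combination of `v` and `T` that kills the negative coordinate has nonnegative square, namely
`t² B(v,v) + a² B(T,T)`. If `B(v,v) ≤ 0`, this forces `a = 0`; then `B(v,v)` is a sum of squares of
the remaining coordinates, so `v = 0`. -/
theorem isLorentzForm_of_basis {d : ℕ} {B : V →L[ℝ] V →L[ℝ] ℝ} (hs : ∀ v w, B v w = B w v)
    (b : Module.Basis (Fin (d + 1)) ℝ V)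
    (hb : ∀ i j, B (b i) (b j) = if i = j then (if i = 0 then -1 else 1) else 0) :
    IsLorentzForm B := by
  have key : ∀ w, B w w = ∑ i, (if i = 0 then -1 else 1) * (b.repr w i) ^ 2 := by
    intro w
    conv_lhs => rw [← b.sum_repr w]
    simp only [map_sum, map_smul, sum_apply, smul_apply,
      hb, smul_eq_mul]
    refine Finset.sum_congr rfl fun i _ ↦ ?_
    simp only [mul_ite, mul_zero, Finset.sum_ite_eq', Finset.mem_univ, if_true]
    split_ifs <;> ring
  simp only [Fin.sum_univ_succ, if_true, Fin.succ_ne_zero, if_false, one_mul] at key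
  refine ⟨hs, fun T v hT hvT hv ↦ ?_⟩
  by_contra! hneg
  set t := b.repr T 0
  set a := b.repr v 0
  have hw := key (t • v - a • T)
  have e : B (t • v - a • T) (t • v - a • T) = t ^ 2 * B v v + a ^ 2 * B T T := by
    simp only [map_sub, map_smul, sub_apply, smul_apply,
      smul_eq_mul, hs T v, hvT]
    ring
  have h0 : b.repr (t • v - a • T) 0 = 0 := by simp [t, a, mul_comm]
  rw [e, h0] at hw
  have hpos : 0 ≤ ∑ i : Fin d, (b.repr (t • v - a • T) i.succ) ^ 2 :=
    Finset.sum_nonneg fun i _ ↦ sq_nonneg _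
  have ha : a = 0 := by
    by_contra ha
    have : 0 < a ^ 2 := by positivity
    nlinarith [sq_nonneg t, mul_nonneg (sq_nonneg t) (neg_nonneg.2 hneg)]
  have hv' := key v
  change _ = -1 * a ^ 2 + _ at hv'
  rw [ha] at hv'
  have hz : ∑ i : Fin d, (b.repr v i.succ) ^ 2 = 0 :=
    le_antisymm (by linarith) (Finset.sum_nonneg fun i _ ↦ sq_nonneg _)
  rw [Finset.sum_eq_zero_iff_of_nonneg fun i _ ↦ sq_nonneg _] at hz
  refine hv (b.ext_elem fun i ↦ ?_)
  rw [map_zero, Finsupp.zero_apply]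
  refine Fin.cases ha (fun j ↦ ?_) i
  simpa using hz j (Finset.mem_univ _)

namespace IsLorentzForm

variable {B G G' : V →L[ℝ] V →L[ℝ] ℝ} {T v w : V}

theorem apply_neg (hB : IsLorentzForm B) (hT : B T T < 0) (hv : B v v ≤ 0) (hvT : B v T ≤ 0)
    (h0 : v ≠ 0) : B v T < 0 :=
  lt_of_le_of_ne hvT fun h ↦ (hB.2 T v hT h h0).not_ge hv

/-- The reverse Cauchy-Schwarz inequality for vectors in the same half of the cone. -/
theorem apply_nonpos (hB : IsLorentzForm B) (hT : B T T < 0) (hv : B v v ≤ 0) (hvT : B v T ≤ 0)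
    (hw : B w w ≤ 0) (hwT : B w T ≤ 0) : B v w ≤ 0 := by
  rcases eq_or_ne v 0 with rfl | hv0
  · simp
  rcases eq_or_ne w 0 with rfl | hw0
  · simp
  have h1 := hB.apply_neg hT hv hvT hv0
  have h2 := hB.apply_neg hT hw hwT hw0
  set a := B v T
  set b := B w T
  -- This combination is orthogonal to `T`, hence has nonnegative square; as `a * b > 0`, a positive
  -- `B v w` would make the square negative.
  have hu : B (b • v - a • w) T = 0 := by
    simp [a, b, mul_comm]
  have h3 : 0 ≤ B (b • v - a • w) (b • v - a • w) := by
    rcases eq_or_ne (b • v - a • w) 0 with h | h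
    · simp [h]
    · exact (hB.2 T _ hT hu h).le
  have e : B (b • v - a • w) (b • v - a • w) =
      b ^ 2 * B v v + a ^ 2 * B w w - 2 * (a * b) * B v w := by
    simp only [map_sub, map_smul, sub_apply, smul_apply,
      smul_eq_mul, hB.1 w v]
    ring
  rw [e] at h3
  by_contra! hpos
  have h4 : 0 < a * b := mul_pos_of_neg_of_neg h1 h2
  nlinarith [mul_pos h4 hpos, mul_nonneg (sq_nonneg b) (neg_nonneg.2 hv),
    mul_nonneg (sq_nonneg a) (neg_nonneg.2 hw)]

/-- The sum of two forms with nested cones is a form with an intermediate cone. -/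
theorem add (hs : ∀ v w, G v w = G w v) (hG' : IsLorentzForm G')
    (h : ∀ v, v ≠ 0 → G v v ≤ 0 → G' v v < 0) : IsLorentzForm (G + G') := by
  refine ⟨fun v w ↦ by simp [hs v w, hG'.1 v w], fun T v hT hvT hv ↦ ?_⟩
  have hneg : ∀ u, u ≠ 0 → (G + G') u u ≤ 0 → G' u u < 0 := by
    intro u hu hu'
    simp only [add_apply] at hu'
    rcases le_or_gt (G u u) 0 with hc | hc
    · exact h u hu hc
    · linarith
  have hT0 : T ≠ 0 := by
    rintro rfl
    simp at hT
  have hT' := hneg T hT0 hT.le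
  by_contra! hle
  set a := G' T T
  set b := G' v T
  have hsym : (G + G') T v = 0 := by
    rw [← hvT]
    simp [hs T v, hG'.1 T v]
  -- The vector `a • v - b • T` is `G'`-orthogonal to `T`, so `G'`-positive unless zero; but its
  -- square for `G + G'` is nonpositive, which by `hneg` makes it `G'`-timelike.
  have e : (G + G') (a • v - b • T) (a • v - b • T) =
      a ^ 2 * (G + G') v v + b ^ 2 * (G + G') T T := by
    simp only [map_sub, map_smul, sub_apply, smul_apply,
      smul_eq_mul, hsym, hvT]
    ring
  rcases eq_or_ne (a • v - b • T) 0 with h0 | h0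
  · have hb : b * (G + G') T T = 0 := by
      have := congrArg (fun u ↦ (G + G') u T) h0
      simp only [map_sub, map_smul, sub_apply,
        smul_apply, smul_eq_mul, hvT, map_zero,
        zero_apply] at this
      linarith
    have hb0 : b = 0 := (mul_eq_zero.1 hb).resolve_right hT.ne
    rw [hb0, zero_smul, sub_zero] at h0
    exact hv ((smul_eq_zero.1 h0).resolve_left hT'.ne)
  · have h1 := hG'.2 T (a • v - b • T) hT' (by simp [a, b, mul_comm]) h0
    have h2 := hneg _ h0 (by
      rw [e]
      nlinarith [mul_nonneg (sq_nonneg a) (neg_nonneg.2 hle),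
        mul_nonneg (sq_nonneg b) (neg_nonneg.2 hT.le)])
    exact lt_asymm h1 h2

/-- Enlarging the cone keeps future directed vectors future directed. -/
theorem future_of_prec (hs : ∀ v w, G v w = G w v) (hG' : IsLorentzForm G')
    (h : ∀ v, v ≠ 0 → G v v ≤ 0 → G' v v < 0) (hT : G T T < 0) (hv : G v v ≤ 0)
    (hvT : G v T ≤ 0) (h0 : v ≠ 0) : G' v v < 0 ∧ G' v T < 0 := by
  refine ⟨h v h0 hv, ?_⟩
  have hT0 : T ≠ 0 := by
    rintro rfl
    simp at hT
  have hT' := h T hT0 hT.le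
  by_contra! hpos
  -- Chosen so that `v + c • T` is `G'`-orthogonal to `T`. Since `c ≥ 0`, this vector is still
  -- nonzero and `G`-causal, hence `G'`-timelike, which is impossible.
  set c := G' v T / (-G' T T)
  have hc : 0 ≤ c := div_nonneg hpos (by linarith)
  have hc' : c * G' T T = - G' v T := by
    rw [div_mul_eq_mul_div, div_neg, mul_div_cancel_right₀ _ hT'.ne]
  have hu0 : v + c • T ≠ 0 := by
    intro hu
    rcases hc.eq_or_lt with hc0 | hc0
    · rw [← hc0, zero_smul, add_zero] at hu
      exact h0 hu
    · have := congrArg (fun u ↦ G u T) hu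
      simp only [map_add, map_smul, add_apply,
        smul_apply, smul_eq_mul, map_zero,
        zero_apply] at this
      nlinarith
  have hu : G (v + c • T) (v + c • T) ≤ 0 := by
    simp only [map_add, map_smul, add_apply,
      smul_apply, smul_eq_mul, hs T v]
    nlinarith [mul_nonneg hc (neg_nonneg.2 hvT), mul_nonneg (mul_nonneg hc hc) (neg_nonneg.2 hT.le)]
  have h1 := h _ hu0 hu
  have h2 := hG'.2 T (v + c • T) hT' (by simp [hc']) hu0
  exact lt_asymm h1 h2

end IsLorentzForm

end LinearAlgebra

/-! ### Future cones and a cone between two metrics -/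

section Cones

variable {E : Type*} [NormedAddCommGroup E] [NormedSpace ℝ E]

/-- The future half of the cone of `B`, with respect to the time orientation `T`. -/
def futureCone (B : E →L[ℝ] E →L[ℝ] ℝ) (T : E) : Set E := {v | B v v ≤ 0 ∧ B v T ≤ 0}

theorem isClosed_futureCone (B : E →L[ℝ] E →L[ℝ] ℝ) (T : E) : IsClosed (futureCone B T) :=
  (isClosed_le (f := fun v ↦ B v v) (by fun_prop) continuous_const).inter
    (isClosed_le (f := fun v ↦ B v T) (by fun_prop) continuous_const)

theorem smul_mem_futureCone {B : E →L[ℝ] E →L[ℝ] ℝ} {T v : E} (hv : v ∈ futureCone B T) {c : ℝ}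
    (hc : 0 ≤ c) : c • v ∈ futureCone B T := by
  simp only [futureCone, Set.mem_ofPred_eq, map_smul, smul_apply,
    smul_eq_mul] at hv ⊢
  exact ⟨mul_nonpos_of_nonneg_of_nonpos hc (mul_nonpos_of_nonneg_of_nonpos hc hv.1),
    mul_nonpos_of_nonneg_of_nonpos hc hv.2⟩

theorem convex_futureCone {B : E →L[ℝ] E →L[ℝ] ℝ} {T : E} (hB : IsLorentzForm B)
    (hT : B T T < 0) : Convex ℝ (futureCone B T) := by
  intro v hv w hw a b ha hb _
  have h1 := smul_mem_futureCone hv ha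
  have h2 := smul_mem_futureCone hw hb
  have h3 := hB.apply_nonpos hT h1.1 h1.2 h2.1 h2.2
  have h4 := hB.1 (a • v) (b • w)
  refine ⟨?_, ?_⟩
  · rw [map_add, map_add, add_apply, add_apply]
    linarith [h1.1, h2.1]
  · rw [map_add, add_apply]
    linarith [h1.2, h2.2]

/-- Near a point where the cone of `G` is inside the cone of `G'`, there is a fixed closed convex
cone between them, whose vectors can moreover be perturbed within the cones of `G'`. -/
theorem exists_intermediate_cone [FiniteDimensional ℝ E] {X : Type*} [TopologicalSpace X]
    {G G' : X → E →L[ℝ] E →L[ℝ] ℝ} {T : X → E} {p : X} (hG : ContinuousAt G p)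
    (hG' : ContinuousAt G' p) (hT : ContinuousAt T p) (hs : ∀ v w, G p v w = G p w v)
    (hL : IsLorentzForm (G' p)) (h : ∀ v, v ≠ 0 → G p v v ≤ 0 → G' p v v < 0)
    (hTp : G p (T p) (T p) < 0) :
    ∃ C : Set E, IsClosed C ∧ Convex ℝ C ∧ (∀ v ∈ C, ∀ c : ℝ, 0 ≤ c → c • v ∈ C) ∧
      ∃ δ > 0, ∀ᶠ x in 𝓝 p, (∀ v, G x v v ≤ 0 → G x v (T x) ≤ 0 → v ∈ C) ∧
        ∀ v ∈ C, ∀ u, ‖u - v‖ < δ * ‖v‖ → G' x u u ≤ 0 ∧ G' x u (T x) ≤ 0 := by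
  have : ProperSpace E := FiniteDimensional.proper ℝ E
  have hTp0 : T p ≠ 0 := by
    intro h0
    simp [h0] at hTp
  have hTp' := h _ hTp0 hTp.le
  -- The cone of the sum lies strictly between: `G`-causal implies `Q`-timelike, and `Q`-causal
  -- implies `G'`-timelike.
  set Q := G p + G' p with hQdef
  have hQ : IsLorentzForm Q := hL.add hs h
  have hQT : Q (T p) (T p) < 0 := by
    simp only [hQdef, add_apply]
    linarith
  have hGQ : ∀ v, v ≠ 0 → G p v v ≤ 0 → Q v v < 0 := by
    intro v hv hv'
    have := h v hv hv'
    simp only [hQdef, add_apply]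
    linarith
  have hQG' : ∀ v, v ≠ 0 → Q v v ≤ 0 → G' p v v < 0 := by
    intro v hv hv'
    simp only [hQdef, add_apply] at hv'
    rcases le_or_gt (G p v v) 0 with hc | hc
    · exact h v hv hc
    · linarith
  refine ⟨futureCone Q (T p), isClosed_futureCone _ _, convex_futureCone hQ hQT,
    fun v hv c hc ↦ smul_mem_futureCone hv hc, ?_⟩
  -- By compactness of the sphere it suffices to work near each unit `v`: either `v` violates a
  -- condition at `p`, which persists nearby, or it is strictly inside the cone of `Q`.
  have h1 : ∀ᶠ x in 𝓝 p, ∀ v ∈ Metric.sphere (0 : E) 1,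
      G x v v ≤ 0 → G x v (T x) ≤ 0 → v ∈ futureCone Q (T p) := by
    refine (isCompact_sphere (0 : E) 1).eventually_forall_of_forall_eventually fun v hv ↦ ?_
    have hv0 : v ≠ 0 := Metric.ne_of_mem_sphere hv one_ne_zero
    have c1 : ContinuousAt (fun z : X × E ↦ G z.1) (p, v) :=
      ContinuousAt.comp (f := Prod.fst) (g := G) hG continuousAt_fst
    have c2 : ContinuousAt (fun z : X × E ↦ T z.1) (p, v) :=
      ContinuousAt.comp (f := Prod.fst) (g := T) hT continuousAt_fst
    have c3 : ContinuousAt (fun z : X × E ↦ G z.1 z.2 z.2) (p, v) :=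
      (c1.clm_apply continuousAt_snd).clm_apply continuousAt_snd
    have c4 : ContinuousAt (fun z : X × E ↦ G z.1 z.2 (T z.1)) (p, v) :=
      (c1.clm_apply continuousAt_snd).clm_apply c2
    rcases lt_or_ge 0 (G p v v) with hv1 | hv1
    · filter_upwards [c3.eventually (lt_mem_nhds hv1)] with z hz hz'
      exact absurd hz' hz.not_ge
    rcases lt_or_ge 0 (G p v (T p)) with hv2 | hv2
    · filter_upwards [c4.eventually (lt_mem_nhds hv2)] with z hz _ hz'
      exact absurd hz' hz.not_ge
    have hv3 := hQ.future_of_prec hs hGQ hTp hv1 hv2 hv0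
    have c5 : ContinuousAt (fun z : X × E ↦ Q z.2 z.2) (p, v) := by fun_prop
    have c6 : ContinuousAt (fun z : X × E ↦ Q z.2 (T p)) (p, v) := by fun_prop
    filter_upwards [c5.eventually (gt_mem_nhds hv3.1), c6.eventually (gt_mem_nhds hv3.2)]
      with z hz hz' _ _
    exact ⟨hz.le, hz'.le⟩
  -- The second component of `y` is the perturbation of `v`; its uniform size becomes `δ`, and
  -- homogeneity turns it into the relative bound `δ * ‖v‖`.
  have h2 : ∀ᶠ y : X × E in 𝓝 (p, 0), ∀ v ∈ Metric.sphere (0 : E) 1 ∩ futureCone Q (T p),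
      G' y.1 (v + y.2) (v + y.2) < 0 ∧ G' y.1 (v + y.2) (T y.1) < 0 := by
    refine ((isCompact_sphere (0 : E) 1).inter_right
      (isClosed_futureCone _ _)).eventually_forall_of_forall_eventually fun v hv ↦ ?_
    have hv0 : v ≠ 0 := Metric.ne_of_mem_sphere hv.1 one_ne_zero
    have hv3 := hL.future_of_prec hQ.1 hQG' hQT hv.2.1 hv.2.2 hv0
    have c0 : ContinuousAt (fun z : (X × E) × E ↦ z.1.1) ((p, 0), v) := by fun_prop
    have c1 : ContinuousAt (fun z : (X × E) × E ↦ G' z.1.1) ((p, 0), v) :=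
      ContinuousAt.comp (f := fun z : (X × E) × E ↦ z.1.1) (g := G') hG' c0
    have c2 : ContinuousAt (fun z : (X × E) × E ↦ T z.1.1) ((p, 0), v) :=
      ContinuousAt.comp (f := fun z : (X × E) × E ↦ z.1.1) (g := T) hT c0
    have c3 : ContinuousAt (fun z : (X × E) × E ↦ z.2 + z.1.2) ((p, 0), v) := by fun_prop
    have c4 := (c1.clm_apply c3).clm_apply c3
    have c5 := (c1.clm_apply c3).clm_apply c2
    filter_upwards [c4.eventually (gt_mem_nhds (by simpa using hv3.1)),
      c5.eventually (gt_mem_nhds (by simpa using hv3.2))] with z hz hz'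
    exact ⟨hz, hz'⟩
  rw [nhds_prod_eq, Filter.eventually_prod_iff] at h2
  obtain ⟨pa, hpa, pb, hpb, hab⟩ := h2
  obtain ⟨δ, hδ, hδb⟩ := Metric.eventually_nhds_iff.1 hpb
  refine ⟨δ, hδ, ?_⟩
  filter_upwards [h1, hpa] with x hx hx'
  refine ⟨fun v hv hvT ↦ ?_, fun v hv u hu ↦ ?_⟩
  · rcases eq_or_ne v 0 with rfl | hv0
    · simp [futureCone]
    have hn : 0 < ‖v‖ := norm_pos_iff.2 hv0
    have hi : 0 ≤ ‖v‖⁻¹ := by positivity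
    have := hx (‖v‖⁻¹ • v) (by simp [norm_smul, hn.ne'])
      (smul_mem_futureCone (B := G x) (T := T x) ⟨hv, hvT⟩ hi).1
      (smul_mem_futureCone (B := G x) (T := T x) ⟨hv, hvT⟩ hi).2
    have h3 := smul_mem_futureCone this hn.le
    rwa [smul_smul, mul_inv_cancel₀ hn.ne', one_smul] at h3
  · rcases eq_or_ne v 0 with rfl | hv0
    · simp only [norm_zero, mul_zero] at hu
      exact absurd hu (norm_nonneg _).not_gt
    have hn : 0 < ‖v‖ := norm_pos_iff.2 hv0
    have hi : 0 ≤ ‖v‖⁻¹ := by positivity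
    have h3 := hab hx' (y := ‖v‖⁻¹ • (u - v)) (hδb (by
      rw [dist_zero_right, norm_smul, norm_inv, norm_norm, inv_mul_lt_iff₀ hn]
      linarith)) (‖v‖⁻¹ • v) ⟨by simp [norm_smul, hn.ne'], smul_mem_futureCone hv hi⟩
    rw [← smul_add, add_sub_cancel] at h3
    have h4 : ‖v‖⁻¹ • u ∈ futureCone (G' x) (T x) := ⟨h3.1.le, h3.2.le⟩
    have h5 := smul_mem_futureCone h4 hn.le
    rwa [smul_smul, mul_inv_cancel₀ hn.ne', one_smul] at h5

end Cones

/-! ### Causal curves and the causal relation -/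

noncomputable section

namespace LorentzMetric

variable {d : ℕ} {M : Type*} [TopologicalSpace M]
  [ChartedSpace (EuclideanSpace ℝ (Fin (d + 1))) M] [IsManifold (𝓡 (d + 1)) ∞ M]
  {g g' : LorentzMetric d M} {τ : g.TimeOrientation} {γ γ₁ γ₂ : ℝ → M} {J J' : Set ℝ} {a b c : ℝ}

theorem isLorentzForm (g : LorentzMetric d M) (x : M) : IsLorentzForm (g.form x) := by
  obtain ⟨b, hb⟩ := g.signature x
  exact isLorentzForm_of_basis (g.symm x) b hb

/-- The opposite time orientation. -/
def TimeOrientation.neg (τ : g.TimeOrientation) : g.TimeOrientation where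
  field x := -τ.field x
  continuous_field := by
    have h : ContMDiff (𝓡 (d + 1)) (𝓡 (d + 1)).tangent 0
        (fun x ↦ (⟨x, τ.field x⟩ : TangentBundle (𝓡 (d + 1)) M)) :=
      contMDiff_zero_iff.2 τ.continuous_field
    exact (h.neg_section).continuous
  timelike_field x := by
    have := τ.timelike_field x
    simpa [IsTimelike] using this

theorem isFutureCausalVector_congr {x y : M} (h : x = y) {v : EuclideanSpace ℝ (Fin (d + 1))}
    (hv : g.IsFutureCausalVector τ (x := x) v) : g.IsFutureCausalVector τ (x := y) v := by
  subst h
  exact hv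

theorem IsFutureCausalVector.of_prec (h : g.Prec g') {x : M} {v : TangentSpace (𝓡 (d + 1)) x}
    (hv : g.IsFutureCausalVector τ v) : g'.IsFutureCausalVector (τ.ofPrec h) v := by
  rcases eq_or_ne v 0 with rfl | h0
  · simp [IsFutureCausalVector, IsCausalVector]
  · have := (g'.isLorentzForm x).future_of_prec (g.symm x) (h x) (τ.timelike_field x) hv.1 hv.2 h0
    exact ⟨this.1.le, this.2.le⟩

namespace IsFutureCurve

theorem mono (hγ : g.IsFutureCurve τ γ J) (h : J' ⊆ J) (hJ' : J'.OrdConnected) :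
    g.IsFutureCurve τ γ J' where
  ordConnected := hJ'
  continuousOn := hγ.continuousOn.mono h
  lipschitz t ht := by
    obtain ⟨K, s, hs, hK⟩ := hγ.lipschitz t (h ht)
    exact ⟨K, s, nhdsWithin_mono t h hs, hK⟩
  velocity := by
    filter_upwards [hγ.velocity] with t ht htJ
    obtain ⟨v, hv, hv'⟩ := ht (h htJ)
    exact ⟨v, hv.mono h, hv'⟩

theorem of_prec (hγ : g.IsFutureCurve τ γ J) (h : g.Prec g') :
    g'.IsFutureCurve (τ.ofPrec h) γ J where
  ordConnected := hγ.ordConnected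
  continuousOn := hγ.continuousOn
  lipschitz := hγ.lipschitz
  velocity := by
    filter_upwards [hγ.velocity] with t ht htJ
    obtain ⟨v, hv, hv'⟩ := ht htJ
    exact ⟨v, hv, hv'.of_prec h⟩

theorem congr (hγ : g.IsFutureCurve τ γ₁ J) (h : Set.EqOn γ₂ γ₁ J) : g.IsFutureCurve τ γ₂ J where
  ordConnected := hγ.ordConnected
  continuousOn := hγ.continuousOn.congr h
  lipschitz t ht := by
    obtain ⟨K, s, hs, hK⟩ := hγ.lipschitz t ht
    refine ⟨K, s ∩ J, Filter.inter_mem hs self_mem_nhdsWithin, fun u hu w hw ↦ ?_⟩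
    simp only [h ht, h hu.2, h hw.2]
    exact hK hu.1 hw.1
  velocity := by
    filter_upwards [hγ.velocity] with t ht htJ
    obtain ⟨v, hv, hv'⟩ := ht htJ
    have hv₂ := HasMFDerivWithinAt.congr_mono hv h (h htJ) subset_rfl
    exact ⟨v, hv₂, isFutureCausalVector_congr (h htJ).symm hv'⟩

/-- Away from `b` everything is local to one piece. The single time `b` is negligible for the
velocity, and Lipschitz estimates across `b` add up because distances on the line do. -/
theorem union (h₁ : g.IsFutureCurve τ γ (Set.Icc a b)) (h₂ : g.IsFutureCurve τ γ (Set.Icc b c))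
    (hab : a ≤ b) (hbc : b ≤ c) : g.IsFutureCurve τ γ (Set.Icc a c) := by
  have hU : Set.Icc a c = Set.Icc a b ∪ Set.Icc b c := (Set.Icc_union_Icc_eq_Icc hab hbc).symm
  have hl : ∀ t < b, 𝓝[Set.Icc a b] t = 𝓝[Set.Icc a c] t := fun t ht ↦
    nhdsWithin_eq_nhdsWithin (s := Set.Iio b) ht isOpen_Iio (by
      ext u
      simp only [Set.mem_inter_iff, Set.mem_Icc, Set.mem_Iio]
      constructor <;> rintro ⟨⟨_, _⟩, _⟩ <;> refine ⟨⟨?_, ?_⟩, ?_⟩ <;> linarith)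
  have hr : ∀ t, b < t → 𝓝[Set.Icc b c] t = 𝓝[Set.Icc a c] t := fun t ht ↦
    nhdsWithin_eq_nhdsWithin (s := Set.Ioi b) ht isOpen_Ioi (by
      ext u
      simp only [Set.mem_inter_iff, Set.mem_Icc, Set.mem_Ioi]
      constructor <;> rintro ⟨⟨_, _⟩, _⟩ <;> refine ⟨⟨?_, ?_⟩, ?_⟩ <;> linarith)
  refine ⟨Set.ordConnected_Icc, ?_, fun t ht ↦ ?_, ?_⟩
  · rw [hU]
    exact h₁.continuousOn.union_of_isClosed h₂.continuousOn isClosed_Icc isClosed_Icc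
  · rcases lt_trichotomy t b with htb | rfl | htb
    · rw [← hl t htb]
      exact h₁.lipschitz t ⟨ht.1, htb.le⟩
    · obtain ⟨K₁, s₁, hs₁, hK₁⟩ := h₁.lipschitz t ⟨hab, le_rfl⟩
      obtain ⟨K₂, s₂, hs₂, hK₂⟩ := h₂.lipschitz t ⟨le_rfl, hbc⟩
      have ht₁ := mem_of_mem_nhdsWithin (Set.right_mem_Icc.2 hab) hs₁
      have ht₂ := mem_of_mem_nhdsWithin (Set.left_mem_Icc.2 hbc) hs₂
      refine ⟨max K₁ K₂, s₁ ∩ Set.Icc a t ∪ s₂ ∩ Set.Icc t c, ?_, ?_⟩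
      · rw [hU, nhdsWithin_union]
        exact ⟨Filter.mem_of_superset (Filter.inter_mem hs₁ self_mem_nhdsWithin)
          Set.subset_union_left, Filter.mem_of_superset
          (Filter.inter_mem hs₂ self_mem_nhdsWithin) Set.subset_union_right⟩
      · replace hK₁ := hK₁.weaken (le_max_left K₁ K₂)
        replace hK₂ := hK₂.weaken (le_max_right K₁ K₂)
        have key : ∀ u ∈ s₁ ∩ Set.Icc a t, ∀ w ∈ s₂ ∩ Set.Icc t c,
            dist (extChartAt (𝓡 (d + 1)) (γ t) (γ u)) (extChartAt (𝓡 (d + 1)) (γ t) (γ w)) ≤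
              (max K₁ K₂ : ℝ≥0) * dist u w := by
          intro u hu w hw
          have e1 := hK₁.dist_le_mul u hu.1 t ht₁
          have e2 := hK₂.dist_le_mul t ht₂ w hw.1
          have e3 : dist u w = dist u t + dist t w := by
            rw [Real.dist_eq, Real.dist_eq, Real.dist_eq, abs_of_nonpos, abs_of_nonpos,
              abs_of_nonpos] <;> linarith [hu.2.2, hw.2.1]
          rw [e3, mul_add]
          exact (dist_triangle _ _ _).trans (add_le_add e1 e2)
        refine LipschitzOnWith.of_dist_le_mul fun u hu w hw ↦ ?_
        rcases hu with hu | hu <;> rcases hw with hw | hw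
        · exact hK₁.dist_le_mul u hu.1 w hw.1
        · exact key u hu w hw
        · rw [dist_comm, dist_comm u]
          exact key w hw u hu
        · exact hK₂.dist_le_mul u hu.1 w hw.1
    · rw [← hr t htb]
      exact h₂.lipschitz t ⟨htb.le, ht.2⟩
  · filter_upwards [h₁.velocity, h₂.velocity, Measure.ae_ne volume b] with t ht₁ ht₂ htb ht
    rcases lt_or_gt_of_ne htb with h | h
    · obtain ⟨v, hv, hv'⟩ := ht₁ ⟨ht.1, h.le⟩
      exact ⟨v, hv.mono_of_mem_nhdsWithin (hl t h ▸ self_mem_nhdsWithin), hv'⟩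
    · obtain ⟨v, hv, hv'⟩ := ht₂ ⟨h.le, ht.2⟩
      exact ⟨v, hv.mono_of_mem_nhdsWithin (hr t h ▸ self_mem_nhdsWithin), hv'⟩

theorem const (x : M) (hJ : J.OrdConnected) : g.IsFutureCurve τ (fun _ ↦ x) J where
  ordConnected := hJ
  continuousOn := continuousOn_const
  lipschitz t _ := ⟨0, Set.univ, Filter.univ_mem, (LipschitzWith.const _).lipschitzOnWith⟩
  velocity := by
    refine Filter.Eventually.of_forall fun t _ ↦ ⟨0, ?_, ?_⟩
    · rw [ContinuousLinearMap.smulRight_zero]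
      exact hasMFDerivWithinAt_const x J t
    · simp [IsFutureCausalVector, IsCausalVector]

/-- Affine reparametrization; the time orientation is reversed together with the time. -/
theorem comp_affine (hγ : g.IsFutureCurve τ γ J) {e : ℝ} (he : e ≠ 0) (c : ℝ)
    {τ' : g.TimeOrientation} (hτ : ∀ x, τ'.field x = e • τ.field x) :
    g.IsFutureCurve τ' (fun s ↦ γ (e * s + c)) {s | e * s + c ∈ J} where
  ordConnected := by
    refine ⟨fun x hx y hy z hz ↦ ?_⟩
    rcases lt_or_gt_of_ne he with h | h
    · exact hγ.ordConnected.out hy hx ⟨by nlinarith [hz.1, hz.2], by nlinarith [hz.1, hz.2]⟩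
    · exact hγ.ordConnected.out hx hy ⟨by nlinarith [hz.1, hz.2], by nlinarith [hz.1, hz.2]⟩
  continuousOn := hγ.continuousOn.comp (f := fun s ↦ e * s + c) (by fun_prop) fun _ h ↦ h
  lipschitz t ht := by
    obtain ⟨K, s, hs, hK⟩ := hγ.lipschitz _ ht
    have hf : LipschitzWith ‖e‖₊ (fun s ↦ e * s + c) := LipschitzWith.of_dist_le_mul fun x y ↦ by
      simp [Real.dist_eq, ← mul_sub, abs_mul]
    refine ⟨K * ‖e‖₊, (fun s ↦ e * s + c) ⁻¹' s, ?_, ?_⟩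
    · have h1 : ContinuousWithinAt (fun s ↦ e * s + c) {s | e * s + c ∈ J} t := by fun_prop
      exact (h1.tendsto_nhdsWithin fun _ h ↦ h) hs
    · exact hK.comp hf.lipschitzOnWith fun _ h ↦ h
  velocity := by
    have hq : Measure.QuasiMeasurePreserving (fun s : ℝ ↦ e * s + c) volume volume := by
      have h1 : Measure.QuasiMeasurePreserving (fun s : ℝ ↦ e * s) volume volume := by
        refine ⟨by fun_prop, ?_⟩
        rw [Real.map_volume_mul_left he]
        exact Measure.smul_absolutelyContinuous
      exact (measurePreserving_add_right volume c).quasiMeasurePreserving.comp h1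
    filter_upwards [hq.ae hγ.velocity] with t ht htJ
    obtain ⟨v, hv, hv'⟩ := ht htJ
    refine ⟨e • v, ?_, ?_⟩
    · have hd : HasDerivAt (fun s : ℝ ↦ e * s + c) e t := by
        simpa using ((hasDerivAt_id t).const_mul e).add_const c
      have hm : HasMFDerivWithinAt 𝓘(ℝ, ℝ) 𝓘(ℝ, ℝ) (fun s : ℝ ↦ e * s + c) {s | e * s + c ∈ J} t
          ((1 : ℝ →L[ℝ] ℝ).smulRight e) :=
        hd.hasFDerivAt.hasFDerivWithinAt.hasMFDerivWithinAt
      have := HasMFDerivWithinAt.comp t hv hm fun _ h ↦ h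
      have e1 : (1 : ℝ →L[ℝ] ℝ).smulRight (e • v) =
          ((1 : ℝ →L[ℝ] ℝ).smulRight v).comp ((1 : ℝ →L[ℝ] ℝ).smulRight e) := by
        ext
        simp
      rw [e1]
      exact this
    -- Both `g(v, v)` and `g(v, T)` get multiplied by `e²`, so the sign of `e` is irrelevant.
    · rw [IsFutureCausalVector, IsCausalVector, hτ]
      simp only [map_smul, smul_apply, smul_eq_mul]
      have := hv'.1
      rw [IsCausalVector] at this
      constructor <;> nlinarith [hv'.2, mul_self_nonneg e]

theorem shift (hγ : g.IsFutureCurve τ γ (Set.Icc a b)) (c : ℝ) :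
    g.IsFutureCurve τ (fun s ↦ γ (s + c)) (Set.Icc (a - c) (b - c)) := by
  have := hγ.comp_affine one_ne_zero c (τ' := τ) (by simp)
  convert this using 2
  · simp
  · ext s
    simp [le_sub_iff_add_le]

theorem reverse (hγ : g.IsFutureCurve τ γ J) :
    g.IsFutureCurve τ.neg (fun s ↦ γ (-s)) {s | -s ∈ J} := by
  have := hγ.comp_affine (neg_ne_zero.2 one_ne_zero) 0 (τ' := τ.neg) (by simp [TimeOrientation.neg])
  simpa using this

end IsFutureCurve

theorem TimeOrientation.neg_neg (τ : g.TimeOrientation) : τ.neg.neg = τ := by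
  cases τ
  simp [TimeOrientation.neg]

/-- Past directed curves thus need no separate treatment: statements proved for every time
orientation apply to `τ.neg`. -/
theorem IsPastCurve.isFutureCurve_neg (hγ : g.IsPastCurve τ γ J) :
    g.IsFutureCurve τ.neg γ J := by
  simpa using IsFutureCurve.reverse hγ

/-- `y` is in the causal future of `x`. -/
def CausalLE (g : LorentzMetric d M) (τ : g.TimeOrientation) (x y : M) : Prop :=
  ∃ (γ : ℝ → M) (a b : ℝ), a ≤ b ∧ g.IsFutureCurve τ γ (Set.Icc a b) ∧ γ a = x ∧ γ b = y

theorem IsFutureCurve.causalLE (hγ : g.IsFutureCurve τ γ J) (ha : a ∈ J) (hb : b ∈ J)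
    (hab : a ≤ b) : g.CausalLE τ (γ a) (γ b) :=
  ⟨γ, a, b, hab, hγ.mono (hγ.ordConnected.out ha hb) Set.ordConnected_Icc, rfl, rfl⟩

namespace CausalLE

variable {x y z : M}

theorem refl (x : M) : g.CausalLE τ x x :=
  ⟨fun _ ↦ x, 0, 0, le_rfl, .const x Set.ordConnected_Icc, rfl, rfl⟩

/-- The middle point is recorded because `antisymm` needs it to see that the loop is not constant.
-/
theorem exists_concat (hxy : g.CausalLE τ x y) (hyz : g.CausalLE τ y z) :
    ∃ (γ : ℝ → M) (a b c : ℝ), a ≤ b ∧ b ≤ c ∧ g.IsFutureCurve τ γ (Set.Icc a c) ∧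
      γ a = x ∧ γ b = y ∧ γ c = z := by
  obtain ⟨γ₁, a, b, hab, h₁, rfl, rfl⟩ := hxy
  obtain ⟨γ₂, b', c, hbc, h₂, hb', rfl⟩ := hyz
  have h₃ := h₂.shift (b' - b)
  rw [sub_sub_cancel] at h₃
  set c' := c - (b' - b) with hc'
  have hbc' : b ≤ c' := by linarith
  have e₁ : Set.EqOn (fun t ↦ if t ≤ b then γ₁ t else γ₂ (t + (b' - b))) γ₁ (Set.Icc a b) :=
    fun t ht ↦ if_pos ht.2
  have e₂ : Set.EqOn (fun t ↦ if t ≤ b then γ₁ t else γ₂ (t + (b' - b)))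
      (fun t ↦ γ₂ (t + (b' - b))) (Set.Icc b c') := by
    intro t ht
    rcases ht.1.eq_or_lt with rfl | hlt
    · simp [hb']
    · exact if_neg hlt.not_ge
  refine ⟨_, a, b, c', hab, hbc', (h₁.congr e₁).union (h₃.congr e₂) hab hbc',
    e₁ ⟨le_rfl, hab⟩, e₁ ⟨hab, le_rfl⟩, (e₂ ⟨hbc', le_rfl⟩).trans ?_⟩
  simp [hc']

theorem trans (hxy : g.CausalLE τ x y) (hyz : g.CausalLE τ y z) : g.CausalLE τ x z := by
  obtain ⟨γ, a, b, c, hab, hbc, h, rfl, -, rfl⟩ := exists_concat hxy hyz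
  exact ⟨γ, a, c, hab.trans hbc, h, rfl, rfl⟩

theorem antisymm (hg : g.IsCausal τ) (hxy : g.CausalLE τ x y) (hyx : g.CausalLE τ y x) :
    x = y := by
  by_contra hne
  obtain ⟨γ, a, b, c, hab, hbc, h, ha, hb, hc⟩ := exists_concat hxy hyx
  have hab' : a < b := hab.lt_of_ne fun h ↦ hne (by rw [← ha, ← hb, h])
  exact hg ⟨γ, a, c, hab'.trans_le hbc, .inl h, ha.trans hc.symm, b, ⟨hab, hbc⟩, by
    rw [ha, hb]
    exact Ne.symm hne⟩

theorem neg (h : g.CausalLE τ x y) : g.CausalLE τ.neg y x := by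
  obtain ⟨γ, a, b, hab, h, rfl, rfl⟩ := h
  refine ⟨fun s ↦ γ (-s), -b, -a, neg_le_neg hab, ?_, by simp, by simp⟩
  convert h.reverse using 1
  ext s
  simp [neg_le, le_neg, and_comm]

theorem of_prec (h : g.Prec g') (hxy : g.CausalLE τ x y) : g'.CausalLE (τ.ofPrec h) x y := by
  obtain ⟨γ, a, b, hab, h', rfl, rfl⟩ := hxy
  exact ⟨γ, a, b, hab, h'.of_prec h, rfl, rfl⟩

end CausalLE

/-- The causally convex hull of a set is causally convex. -/
theorem isCausallyConvex_hull (g : LorentzMetric d M) (τ : g.TimeOrientation) (W : Set M) :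
    g.IsCausallyConvex τ {x | (∃ w ∈ W, g.CausalLE τ w x) ∧ ∃ w ∈ W, g.CausalLE τ x w} := by
  intro γ J hγ
  have hJ : J.OrdConnected := by
    rcases hγ with hγ | hγ
    · exact hγ.ordConnected
    · exact (IsPastCurve.isFutureCurve_neg hγ).ordConnected
  refine Set.OrdConnected.isPreconnected ⟨?_⟩
  rintro s ⟨hs, ⟨w₁, hw₁, h₁⟩, ⟨w₂, hw₂, h₂⟩⟩ t ⟨ht, ⟨w₃, hw₃, h₃⟩, ⟨w₄, hw₄, h₄⟩⟩ u hu
  have huJ := hJ.out hs ht hu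
  refine ⟨huJ, ?_⟩
  rcases hγ with hγ | hγ
  · exact ⟨⟨w₁, hw₁, h₁.trans (hγ.causalLE hs huJ hu.1)⟩,
      ⟨w₄, hw₄, (hγ.causalLE huJ ht hu.2).trans h₄⟩⟩
  -- Along a past directed curve the roles of the two end times are exchanged.
  · have hγ' := IsPastCurve.isFutureCurve_neg hγ
    have h₅ := (hγ'.causalLE hs huJ hu.1).neg
    have h₆ := (hγ'.causalLE huJ ht hu.2).neg
    rw [TimeOrientation.neg_neg] at h₅ h₆
    exact ⟨⟨w₃, hw₃, h₃.trans h₆⟩, ⟨w₂, hw₂, h₅.trans h₂⟩⟩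

end LorentzMetric

end

/-! ### Metrics and causal curves in a chart -/

noncomputable section

theorem comp_one_smulRight {V W : Type*} [AddCommGroup V] [Module ℝ V] [TopologicalSpace V]
    [ContinuousSMul ℝ V] [AddCommGroup W] [Module ℝ W] [TopologicalSpace W] [ContinuousSMul ℝ W]
    (A : V →L[ℝ] W) (v : V) :
    A.comp ((1 : ℝ →L[ℝ] ℝ).smulRight v) = (1 : ℝ →L[ℝ] ℝ).smulRight (A v) := by
  ext
  simp

namespace LorentzMetric

variable {d : ℕ} {M : Type*} [TopologicalSpace M]
  [ChartedSpace (EuclideanSpace ℝ (Fin (d + 1))) M] [IsManifold (𝓡 (d + 1)) ∞ M]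
  {g g' : LorentzMetric d M} {τ : g.TimeOrientation} {γ : ℝ → M} {a b : ℝ} {p x : M}

/-- The differential at `x` of the chart around `p`. -/
def chartDeriv (d : ℕ) {M : Type*} [TopologicalSpace M]
    [ChartedSpace (EuclideanSpace ℝ (Fin (d + 1))) M] [IsManifold (𝓡 (d + 1)) ∞ M] (p x : M) :
    TangentSpace (𝓡 (d + 1)) x →L[ℝ] EuclideanSpace ℝ (Fin (d + 1)) :=
  (trivializationAt (EuclideanSpace ℝ (Fin (d + 1))) (TangentSpace (𝓡 (d + 1)))
    p).continuousLinearMapAt ℝ x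

/-- The differential at the image of `x` of the inverse of the chart around `p`. -/
def chartSymmDeriv (d : ℕ) {M : Type*} [TopologicalSpace M]
    [ChartedSpace (EuclideanSpace ℝ (Fin (d + 1))) M] [IsManifold (𝓡 (d + 1)) ∞ M] (p x : M) :
    EuclideanSpace ℝ (Fin (d + 1)) →L[ℝ] TangentSpace (𝓡 (d + 1)) x :=
  (trivializationAt (EuclideanSpace ℝ (Fin (d + 1))) (TangentSpace (𝓡 (d + 1))) p).symmL ℝ x

theorem mem_baseSet_of_mem_source (hx : x ∈ (extChartAt (𝓡 (d + 1)) p).source) :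
    x ∈ (trivializationAt (EuclideanSpace ℝ (Fin (d + 1)))
      (TangentSpace (𝓡 (d + 1)) (M := M)) p).baseSet := by
  rw [extChartAt_source] at hx
  simpa using hx

theorem chartSymmDeriv_chartDeriv (hx : x ∈ (extChartAt (𝓡 (d + 1)) p).source)
    (v : TangentSpace (𝓡 (d + 1)) x) : chartSymmDeriv d p x (chartDeriv d p x v) = v :=
  Bundle.Trivialization.symmL_continuousLinearMapAt _ (mem_baseSet_of_mem_source hx) v

/-- Identifies the tangent bundle trivialization, in which continuity of `g` and `τ` is expressed,
with the derivative that acts on velocities. -/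
theorem hasMFDerivAt_extChartAt' (hx : x ∈ (extChartAt (𝓡 (d + 1)) p).source) :
    HasMFDerivAt (𝓡 (d + 1)) 𝓘(ℝ, EuclideanSpace ℝ (Fin (d + 1))) (extChartAt (𝓡 (d + 1)) p) x
      (chartDeriv d p x) := by
  rw [extChartAt_source] at hx
  rw [chartDeriv, TangentBundle.continuousLinearMapAt_trivializationAt hx]
  exact (mdifferentiableAt_extChartAt hx).hasMFDerivAt

theorem hasMFDerivAt_extChartAt_symm {y : EuclideanSpace ℝ (Fin (d + 1))}
    (hy : y ∈ (extChartAt (𝓡 (d + 1)) p).target) :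
    HasMFDerivAt 𝓘(ℝ, EuclideanSpace ℝ (Fin (d + 1))) (𝓡 (d + 1))
      (extChartAt (𝓡 (d + 1)) p).symm y
      (chartSymmDeriv d p ((extChartAt (𝓡 (d + 1)) p).symm y)) := by
  have hx := (extChartAt (𝓡 (d + 1)) p).map_target hy
  have hxy := (extChartAt (𝓡 (d + 1)) p).right_inv hy
  rw [extChartAt_source] at hx
  have h := (mdifferentiableWithinAt_extChartAt_symm (I := 𝓡 (d + 1)) hy).hasMFDerivWithinAt
  have h2 := TangentBundle.symmL_trivializationAt (𝕜 := ℝ) (I := 𝓡 (d + 1)) hx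
  rw [hxy] at h2
  rw [chartSymmDeriv, h2]
  rwa [← hasMFDerivWithinAt_univ, ← (𝓡 (d + 1)).range_eq_univ]

/-- The metric in the chart around `p`. -/
def coordForm (g : LorentzMetric d M) (p x : M) :
    EuclideanSpace ℝ (Fin (d + 1)) →L[ℝ] EuclideanSpace ℝ (Fin (d + 1)) →L[ℝ] ℝ :=
  ContinuousLinearMap.inCoordinates (EuclideanSpace ℝ (Fin (d + 1))) (TangentSpace (𝓡 (d + 1)))
    (EuclideanSpace ℝ (Fin (d + 1)) →L[ℝ] ℝ) (fun x : M ↦ TangentSpace (𝓡 (d + 1)) x →L[ℝ] ℝ)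
    p x p x (g.form x)

theorem continuousAt_coordForm (g : LorentzMetric d M) (p : M) :
    ContinuousAt (g.coordForm p) p :=
  ((contMDiffAt_hom_bundle _).1 (g.contMDiff p)).2.continuousAt

theorem coordForm_apply (g : LorentzMetric d M) (hx : x ∈ (extChartAt (𝓡 (d + 1)) p).source)
    (u w : EuclideanSpace ℝ (Fin (d + 1))) :
    g.coordForm p x u w = g.form x (chartSymmDeriv d p x u) (chartSymmDeriv d p x w) := by
  have hx' := mem_baseSet_of_mem_source hx
  rw [coordForm, inCoordinates_apply_eq₂ hx' hx' (Set.mem_univ _)]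
  rw [chartSymmDeriv, Bundle.Trivialization.symmL_apply _ hx',
    Bundle.Trivialization.symmL_apply _ hx']
  simp

theorem coordForm_chartDeriv (g : LorentzMetric d M)
    (hx : x ∈ (extChartAt (𝓡 (d + 1)) p).source) (v w : TangentSpace (𝓡 (d + 1)) x) :
    g.coordForm p x (chartDeriv d p x v) (chartDeriv d p x w) = g.form x v w := by
  rw [coordForm_apply g hx, chartSymmDeriv_chartDeriv hx, chartSymmDeriv_chartDeriv hx]

theorem TimeOrientation.continuousAt_chartDeriv (τ : g.TimeOrientation) (p : M) :
    ContinuousAt (fun x ↦ chartDeriv d p x (τ.field x)) p := by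
  have h : ContMDiff (𝓡 (d + 1)) (𝓡 (d + 1)).tangent 0
      (fun x ↦ (⟨x, τ.field x⟩ : TangentBundle (𝓡 (d + 1)) M)) :=
    contMDiff_zero_iff.2 τ.continuous_field
  have h2 := ((Bundle.contMDiffAt_section _).1 (h p)).continuousAt
  refine h2.congr ?_
  filter_upwards [extChartAt_source_mem_nhds (I := 𝓡 (d + 1)) p] with x hx
  have := mem_baseSet_of_mem_source hx
  rw [chartDeriv, Bundle.Trivialization.continuousLinearMapAt_apply,
    Bundle.Trivialization.coe_linearMapAt_of_mem _ this]

theorem chartDeriv_chartSymmDeriv (hx : x ∈ (extChartAt (𝓡 (d + 1)) p).source)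
    (u : EuclideanSpace ℝ (Fin (d + 1))) : chartDeriv d p x (chartSymmDeriv d p x u) = u :=
  Bundle.Trivialization.continuousLinearMapAt_symmL _ (mem_baseSet_of_mem_source hx) u

theorem contDiffAt_extChartAt_comp_symm {q : M} {y : EuclideanSpace ℝ (Fin (d + 1))}
    (hy : y ∈ (extChartAt (𝓡 (d + 1)) p).target)
    (hq : (extChartAt (𝓡 (d + 1)) p).symm y ∈ (extChartAt (𝓡 (d + 1)) q).source) :
    ContDiffAt ℝ 1 (extChartAt (𝓡 (d + 1)) q ∘ (extChartAt (𝓡 (d + 1)) p).symm) y := by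
  have h1 := contMDiffAt_extChartAt' (I := 𝓡 (d + 1)) (n := ∞) (x := q)
    (by rwa [extChartAt_source] at hq)
  have h2 := (contMDiffOn_extChartAt_symm (I := 𝓡 (d + 1)) (n := ∞) p).contMDiffAt
    ((isOpen_extChartAt_target p).mem_nhds hy)
  exact ((h1.comp y h2).contDiffAt).of_le (by norm_cast)

/-- A curve in a chart whose velocity is almost everywhere in a closed convex cone has its
displacement in that cone. -/
theorem IsFutureCurve.sub_mem_cone {C : Set (EuclideanSpace ℝ (Fin (d + 1)))} (hC : IsClosed C)
    (hconv : Convex ℝ C) (hcone : ∀ v ∈ C, ∀ c : ℝ, 0 ≤ c → c • v ∈ C) (hne : C.Nonempty)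
    (hab : a ≤ b)
    (hγ : g.IsFutureCurve τ γ (Set.Icc a b))
    (hsrc : ∀ t ∈ Set.Icc a b, γ t ∈ (extChartAt (𝓡 (d + 1)) p).source)
    (hv : ∀ t ∈ Set.Icc a b, ∀ v : TangentSpace (𝓡 (d + 1)) (γ t),
      g.IsFutureCausalVector τ v → chartDeriv d p (γ t) v ∈ C) :
    extChartAt (𝓡 (d + 1)) p (γ b) - extChartAt (𝓡 (d + 1)) p (γ a) ∈ C := by
  -- The curve is Lipschitz in the chart at `γ t`; the transition to the chart at `p` is `C¹`, hence
  -- locally Lipschitz.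
  have hloc : LocallyLipschitzOn (Set.Icc a b) (fun t ↦ extChartAt (𝓡 (d + 1)) p (γ t)) := by
    intro t ht
    obtain ⟨K, s, hs, hK⟩ := hγ.lipschitz t ht
    set q := γ t with hq
    obtain ⟨K', s', hs', hK'⟩ := (contDiffAt_extChartAt_comp_symm (d := d) (p := q) (q := p)
      (mem_extChartAt_target q)
      (by rw [extChartAt_to_inv]; exact hsrc t ht)).exists_lipschitzOnWith
    have hc : ContinuousWithinAt (fun u ↦ extChartAt (𝓡 (d + 1)) q (γ u)) (Set.Icc a b) t :=
      (continuousAt_extChartAt (I := 𝓡 (d + 1)) q).comp_continuousWithinAt (hγ.continuousOn t ht)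
    have hs1 : γ ⁻¹' (extChartAt (𝓡 (d + 1)) q).source ∈ 𝓝[Set.Icc a b] t :=
      hγ.continuousOn t ht (extChartAt_source_mem_nhds (I := 𝓡 (d + 1)) q)
    refine ⟨K' * K, s ∩ ((fun u ↦ extChartAt (𝓡 (d + 1)) q (γ u)) ⁻¹' s' ∩
      γ ⁻¹' (extChartAt (𝓡 (d + 1)) q).source), Filter.inter_mem hs
      (Filter.inter_mem (hc hs') hs1), ?_⟩
    have h3 := hK'.comp (hK.mono (Set.inter_subset_left
      (t := (fun u ↦ extChartAt (𝓡 (d + 1)) q (γ u)) ⁻¹' s' ∩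
        γ ⁻¹' (extChartAt (𝓡 (d + 1)) q).source))) (fun u hu ↦ hu.2.1)
    intro u hu w hw
    have h4 := h3 hu hw
    simp only [Function.comp_apply] at h4
    rwa [(extChartAt (𝓡 (d + 1)) q).left_inv hu.2.2,
      (extChartAt (𝓡 (d + 1)) q).left_inv hw.2.2] at h4
  obtain ⟨K, hK⟩ := hloc.exists_lipschitzOnWith_of_compact isCompact_Icc
  by_contra hnot
  -- Since `C` is a cone, the separating functional is nonpositive on it. So `f` along the curve is
  -- absolutely continuous with nonpositive derivative almost everywhere and cannot increase by more
  -- than `u > 0`.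
  obtain ⟨f, u, hfu, hu⟩ := geometric_hahn_banach_closed_point hconv hC hnot
  have h0 : (0 : EuclideanSpace ℝ (Fin (d + 1))) ∈ C := by
    obtain ⟨v, hv⟩ := hne
    simpa using hcone v hv 0 le_rfl
  have hu0 : 0 < u := by simpa using hfu 0 h0
  have hf : ∀ v ∈ C, f v ≤ 0 := by
    intro v hv
    by_contra! hpos
    have h1 := hfu _ (hcone v hv (u / f v) (by positivity))
    rw [map_smul, smul_eq_mul, div_mul_cancel₀ _ hpos.ne'] at h1
    exact lt_irrefl _ h1
  set φ : ℝ → ℝ := fun t ↦ f (extChartAt (𝓡 (d + 1)) p (γ t)) with hφ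
  have hφL : LipschitzOnWith (‖f‖₊ * K) φ (Set.uIcc a b) := by
    rw [Set.uIcc_of_le hab]
    exact f.lipschitz.comp_lipschitzOnWith hK
  have hint := hφL.absolutelyContinuousOnInterval.integral_deriv_eq_sub
  have hd : ∀ᵐ t : ℝ, t ∈ Set.Icc a b → deriv φ t ≤ 0 := by
    filter_upwards [hγ.velocity, Measure.ae_ne volume a, Measure.ae_ne volume b]
      with t ht hta htb htI
    obtain ⟨v, hvt, hvf⟩ := ht htI
    have hm := (hasMFDerivAt_extChartAt' (hsrc t htI)).comp_hasMFDerivWithinAt t hvt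
    have hm1 : HasFDerivWithinAt (extChartAt (𝓡 (d + 1)) p ∘ γ)
        ((1 : ℝ →L[ℝ] ℝ).smulRight (chartDeriv d p (γ t) v)) (Set.Icc a b) t :=
      (hm.congr_mfderiv (comp_one_smulRight (chartDeriv d p (γ t)) v)).hasFDerivWithinAt
    have hm2 := hm1.hasFDerivAt (Icc_mem_nhds (htI.1.lt_of_ne' hta) (htI.2.lt_of_ne htb))
    have hm3 := (f.hasFDerivAt.comp t hm2).hasDerivAt
    have hm4 : deriv φ t = f (chartDeriv d p (γ t) v) := by
      refine hm3.deriv.trans ?_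
      simp
    rw [hm4]
    exact hf _ (hv t htI v hvf)
  have hle : ∫ t in a..b, deriv φ t ≤ 0 := by
    rw [intervalIntegral.integral_of_le hab]
    refine integral_nonpos_of_ae ?_
    rw [Filter.EventuallyLE, ae_restrict_iff' measurableSet_Ioc]
    filter_upwards [hd] with t ht htI
    exact ht ⟨htI.1.le, htI.2⟩
  rw [hint] at hle
  rw [map_sub] at hu
  linarith

/-- A straight segment in a chart is a causal curve if its direction is causal along it. -/
theorem causalLE_segment {y u : EuclideanSpace ℝ (Fin (d + 1))}
    (htgt : ∀ t ∈ Set.Icc (0 : ℝ) 1, y + t • u ∈ (extChartAt (𝓡 (d + 1)) p).target)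
    (hu : ∀ t ∈ Set.Icc (0 : ℝ) 1, g.IsFutureCausalVector τ
      (chartSymmDeriv d p ((extChartAt (𝓡 (d + 1)) p).symm (y + t • u)) u)) :
    g.CausalLE τ ((extChartAt (𝓡 (d + 1)) p).symm y)
      ((extChartAt (𝓡 (d + 1)) p).symm (y + u)) := by
  have hline : ∀ t : ℝ, HasDerivAt (fun t : ℝ ↦ y + t • u) u t := fun t ↦ by
    simpa using ((hasDerivAt_id t).smul_const u).const_add y
  have hcont : Continuous (fun t : ℝ ↦ y + t • u) := by fun_prop
  refine ⟨fun t ↦ (extChartAt (𝓡 (d + 1)) p).symm (y + t • u), 0, 1, zero_le_one,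
    ⟨Set.ordConnected_Icc, ?_, fun t ht ↦ ?_, Filter.Eventually.of_forall fun t ht ↦ ?_⟩,
    by simp, by simp⟩
  · exact (continuousOn_extChartAt_symm p).comp hcont.continuousOn htgt
  · have hL : LipschitzWith ‖u‖₊ (fun t : ℝ ↦ y + t • u) :=
      LipschitzWith.of_dist_le_mul fun s t ↦ by
        rw [dist_add_left, dist_eq_norm, ← sub_smul, norm_smul, mul_comm]
        rfl
    obtain ⟨K, s, hs, hK⟩ := (contDiffAt_extChartAt_comp_symm (htgt t ht)
      (mem_extChartAt_source _)).exists_lipschitzOnWith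
    exact ⟨K * ‖u‖₊, (fun t : ℝ ↦ y + t • u) ⁻¹' s,
      mem_nhdsWithin_of_mem_nhds (hcont.continuousAt hs),
      hK.comp hL.lipschitzOnWith fun _ h ↦ h⟩
  · refine ⟨chartSymmDeriv d p ((extChartAt (𝓡 (d + 1)) p).symm (y + t • u)) u, ?_, hu t ht⟩
    have hm : HasMFDerivAt 𝓘(ℝ, ℝ) 𝓘(ℝ, EuclideanSpace ℝ (Fin (d + 1)))
        (fun t : ℝ ↦ y + t • u) t ((1 : ℝ →L[ℝ] ℝ).smulRight u) :=
      (hline t).hasFDerivAt.hasMFDerivAt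
    have h := (hasMFDerivAt_extChartAt_symm (htgt t ht)).comp t hm
    exact (h.congr_mfderiv (comp_one_smulRight _ u)).hasMFDerivWithinAt

end LorentzMetric

end

/-! ### Leaving a neighbourhood of a point -/

noncomputable section

namespace LorentzMetric

variable {d : ℕ} {M : Type*} [TopologicalSpace M]
  [ChartedSpace (EuclideanSpace ℝ (Fin (d + 1))) M] [IsManifold (𝓡 (d + 1)) ∞ M]
  {g g' : LorentzMetric d M}

/-- A continuous curve from an open set to its complement has a first exit point. -/
theorem exists_first_exit {X : Type*} [TopologicalSpace X] {γ : ℝ → X} {a b : ℝ} {O K : Set X}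
    (hγ : ContinuousOn γ (Set.Icc a b)) (hab : a ≤ b) (hO : IsOpen O) (hK : IsClosed K)
    (hOK : O ⊆ K) (ha : γ a ∈ O) (hb : γ b ∉ O) :
    ∃ c ∈ Set.Icc a b, γ c ∉ O ∧ ∀ t ∈ Set.Icc a c, γ t ∈ K := by
  set A := Set.Icc a b ∩ γ ⁻¹' Oᶜ
  have hA : IsClosed A := hγ.preimage_isClosed_of_isClosed isClosed_Icc hO.isClosed_compl
  have hbA : b ∈ A := ⟨⟨hab, le_rfl⟩, hb⟩
  have hbdd : BddBelow A := ⟨a, fun t ht ↦ ht.1.1⟩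
  have hc : sInf A ∈ A := hA.csInf_mem ⟨b, hbA⟩ hbdd
  -- Makes the exit time a limit of earlier times, at which the curve is in `O ⊆ K`; closedness of
  -- `K` then covers the exit time itself.
  have hac : a ≠ sInf A := fun h ↦ hc.2 (h ▸ ha)
  refine ⟨sInf A, hc.1, hc.2, ?_⟩
  have hsub : Set.Icc a (sInf A) ⊆ Set.Icc a b := Set.Icc_subset_Icc_right hc.1.2
  have h1 : Set.Ico a (sInf A) ⊆ Set.Icc a (sInf A) ∩ γ ⁻¹' K := by
    intro t ht
    refine ⟨⟨ht.1, ht.2.le⟩, hOK ?_⟩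
    by_contra hn
    exact (notMem_of_lt_csInf ht.2 hbdd) ⟨hsub ⟨ht.1, ht.2.le⟩, hn⟩
  have h2 := closure_minimal h1
    ((hγ.mono hsub).preimage_isClosed_of_isClosed isClosed_Icc hK)
  rw [closure_Ico hac] at h2
  exact fun t ht ↦ (h2 ht).2

/-- A `g`-causal curve which starts near `p` and leaves a neighbourhood of `p` passes through a
point other than `p` in the `g'`-causal future of `p`. -/
theorem Prec.exists_nhds_exit [T2Space M] (h : g.Prec g') (τ : g.TimeOrientation) (p : M)
    {V : Set M} (hV : V ∈ 𝓝 p) :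
    ∃ W ∈ 𝓝 p, ∀ w ∈ W, ∀ x ∉ V, g.CausalLE τ w x →
      ∃ z ≠ p, g'.CausalLE (τ.ofPrec h) p z ∧ g.CausalLE τ z x := by
  have hp : p ∈ (extChartAt (𝓡 (d + 1)) p).source := mem_extChartAt_source p
  obtain ⟨C, hC, hconv, hcone, δ, hδ, hev⟩ := exists_intermediate_cone (g.continuousAt_coordForm p)
    (g'.continuousAt_coordForm p) (τ.continuousAt_chartDeriv p)
    (fun v w ↦ by rw [coordForm_apply g hp, coordForm_apply g hp, g.symm])
    ⟨fun v w ↦ by rw [coordForm_apply g' hp, coordForm_apply g' hp, g'.symm],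
      fun T v hT hvT hv ↦ by
        rw [coordForm_apply g' hp] at hT hvT ⊢
        refine (g'.isLorentzForm p).2 _ _ hT hvT fun h0 ↦ hv ?_
        rw [← chartDeriv_chartSymmDeriv hp v, h0, map_zero]⟩
    (fun v hv hv' ↦ by
      rw [coordForm_apply g hp] at hv'
      rw [coordForm_apply g' hp]
      refine h p _ (fun h0 ↦ hv ?_) hv'
      rw [← chartDeriv_chartSymmDeriv hp v, h0, map_zero])
    (by rw [coordForm_chartDeriv g hp]; exact τ.timelike_field p)
  have hCne : C.Nonempty := ⟨0, (hev.self_of_nhds).1 0 (by simp) (by simp)⟩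
  set φ := extChartAt (𝓡 (d + 1)) p with hφ
  -- A coordinate ball inside the chart on which the cone comparison holds and whose points lie in
  -- `V`; halving `R` puts a compact ball inside it.
  obtain ⟨R, hR, hRsub⟩ := Metric.mem_nhds_iff.1 (Filter.inter_mem (extChartAt_target_mem_nhds p)
    ((continuousAt_extChartAt_symm (I := 𝓡 (d + 1)) p) (Filter.inter_mem
      (by rw [extChartAt_to_inv]; exact hev) (by rw [extChartAt_to_inv]; exact hV))))
  set r := R / 2 with hr
  have hr0 : 0 < r := half_pos hR
  have hball : ∀ y ∈ Metric.closedBall (φ p) r, y ∈ φ.target ∧ _ :=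
    fun y hy ↦ hRsub (Metric.closedBall_subset_ball (half_lt_self hR) hy)
  -- Solves `ε = δ * (r - ε)`: replacing `w` by `p` changes the displacement by less than `ε`, while
  -- the displacement from `w` to the exit point has length at least `r - ε`.
  set ε := δ * r / (1 + δ) with hε
  have hε0 : 0 < ε := by positivity
  have hεδ : ε = δ * (r - ε) := by
    rw [hε]
    field_simp
    ring
  have hεr : ε < r := by
    have : 0 < δ * (r - ε) := hεδ ▸ hε0
    linarith [(pos_iff_pos_of_mul_pos this).1 hδ]
  have hopen : ∀ s : ℝ, IsOpen (φ.source ∩ φ ⁻¹' Metric.ball (φ p) s) := fun s ↦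
    (continuousOn_extChartAt p).isOpen_inter_preimage (isOpen_extChartAt_source p)
      Metric.isOpen_ball
  refine ⟨φ.source ∩ φ ⁻¹' Metric.ball (φ p) ε, (hopen ε).mem_nhds ⟨hp, Metric.mem_ball_self hε0⟩,
    ?_⟩
  rintro w hw x hx ⟨γ, a, b, hab, hγ, rfl, rfl⟩
  -- Here `M` being Hausdorff matters: a compact image is closed, so the curve is still in the chart
  -- at its exit time.
  have hKcl : IsClosed (φ.symm '' Metric.closedBall (φ p) r) :=
    ((isCompact_closedBall _ _).image_of_continuousOn
      ((continuousOn_extChartAt_symm p).mono fun y hy ↦ (hball y hy).1)).isClosed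
  obtain ⟨c, hc, hcO, hcK⟩ := exists_first_exit hγ.continuousOn hab (hopen r) hKcl
    (fun z hz ↦ ⟨φ z, Metric.ball_subset_closedBall hz.2, φ.left_inv hz.1⟩)
    ⟨hw.1, Metric.ball_subset_ball hεr.le hw.2⟩
    (fun hb ↦ hx (by
      have := (hball _ (Metric.ball_subset_closedBall hb.2)).2.2
      rwa [← hφ, φ.left_inv hb.1] at this))
  have hγc := hγ.mono (Set.Icc_subset_Icc_right hc.2) Set.ordConnected_Icc
  have hsrc : ∀ t ∈ Set.Icc a c, γ t ∈ φ.source := by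
    intro t ht
    obtain ⟨y, hy, hyt⟩ := hcK t ht
    rw [← hyt]
    exact φ.map_target (hball y hy).1
  have hcone' := hγc.sub_mem_cone (p := p) hC hconv hcone hCne hc.1 hsrc (by
    intro t ht v hv
    have hts := hsrc t ht
    obtain ⟨y, hy, hyt⟩ := hcK t ht
    have h1 := (hball y hy).2.1
    rw [← hφ, hyt] at h1
    refine h1.1 _ ?_ ?_
    · rw [coordForm_chartDeriv g hts]
      exact hv.1
    · rw [coordForm_chartDeriv g hts]
      exact hv.2)
  have hcs := hsrc c ⟨hc.1, le_rfl⟩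
  have hcr : r ≤ ‖φ (γ c) - φ p‖ := by
    by_contra! hlt
    exact hcO ⟨hcs, by rwa [Set.mem_preimage, Metric.mem_ball, dist_eq_norm]⟩
  have hcr' : ‖φ (γ c) - φ p‖ ≤ r := by
    obtain ⟨y, hy, hyt⟩ := hcK c ⟨hc.1, le_rfl⟩
    rw [← hyt, φ.right_inv (hball y hy).1, ← dist_eq_norm]
    exact hy
  have hwε : ‖φ (γ a) - φ p‖ < ε := by
    rw [← dist_eq_norm]
    exact hw.2
  have hclose : ‖(φ (γ c) - φ p) - (φ (γ c) - φ (γ a))‖ < δ * ‖φ (γ c) - φ (γ a)‖ := by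
    rw [sub_sub_sub_cancel_left]
    have h1 : r - ε ≤ ‖φ (γ c) - φ (γ a)‖ := by
      have := norm_sub_le_norm_sub_add_norm_sub (φ (γ c)) (φ (γ a)) (φ p)
      linarith
    have h2 := mul_le_mul_of_nonneg_left h1 hδ.le
    linarith
  refine ⟨γ c, ?_, ?_, hγ.causalLE hc ⟨hab, le_rfl⟩ hc.2⟩
  · intro hcp
    rw [hcp, sub_self, norm_zero] at hcr
    linarith
  -- The direction is fixed and `hclose` does not depend on the point, so it is `g'`-causal along
  -- the entire segment.
  · have hseg : ∀ t ∈ Set.Icc (0 : ℝ) 1,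
        φ p + t • (φ (γ c) - φ p) ∈ Metric.closedBall (φ p) r := by
      intro t ht
      rw [Metric.mem_closedBall, dist_eq_norm, add_sub_cancel_left, norm_smul, Real.norm_eq_abs,
        abs_of_nonneg ht.1]
      exact (mul_le_of_le_one_left (norm_nonneg _) ht.2).trans hcr'
    have := causalLE_segment (g := g') (τ := τ.ofPrec h) (p := p) (y := φ p)
      (u := φ (γ c) - φ p) (fun t ht ↦ (hball _ (hseg t ht)).1) (by
        intro t ht
        have h1 := (hball _ (hseg t ht)).2.1.2 _ hcone' _ hclose
        have h2 := φ.map_target (hball _ (hseg t ht)).1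
        rw [coordForm_apply g' h2, coordForm_apply g' h2, chartSymmDeriv_chartDeriv h2] at h1
        exact h1)
    rw [add_sub_cancel, φ.left_inv hcs, φ.left_inv hp] at this
    exact this

end LorentzMetric

end

/-! ### Stable causality implies strong causality -/

theorem mainTheorem9 {d : ℕ} {M : Type*} [TopologicalSpace M] [T2Space M]
    [ChartedSpace (EuclideanSpace ℝ (Fin (d + 1))) M] [IsManifold (𝓡 (d + 1)) ∞ M]
    (g : LorentzMetric d M) (τ : g.TimeOrientation) (hg : g.IsStablyCausal τ) :
    g.IsStronglyCausal τ := by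
  obtain ⟨g', h, hc⟩ := hg
  intro p V hV
  obtain ⟨W₁, hW₁, h₁⟩ := h.exists_nhds_exit τ p hV
  obtain ⟨W₂, hW₂, h₂⟩ := h.exists_nhds_exit τ.neg p hV
  refine ⟨{x | (∃ w ∈ W₁ ∩ W₂, g.CausalLE τ w x) ∧ ∃ w ∈ W₁ ∩ W₂, g.CausalLE τ x w},
    Filter.mem_of_superset (Filter.inter_mem hW₁ hW₂)
      fun w hw ↦ ⟨⟨w, hw, .refl w⟩, ⟨w, hw, .refl w⟩⟩, ?_, g.isCausallyConvex_hull τ _⟩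
  rintro x ⟨⟨w₁, hw₁, hx₁⟩, ⟨w₂, hw₂, hx₂⟩⟩
  by_contra hx
  obtain ⟨z₁, hz₁, hpz₁, hzx₁⟩ := h₁ w₁ hw₁.1 x hx hx₁
  obtain ⟨z₂, -, hpz₂, hzx₂⟩ := h₂ w₂ hw₂.2 x hx hx₂.neg
  have hzx₂' := hzx₂.neg
  have hpz₂' := hpz₂.neg
  rw [LorentzMetric.TimeOrientation.neg_neg] at hzx₂'
  have hneg : (τ.neg.ofPrec h).neg = τ.ofPrec h :=
    LorentzMetric.TimeOrientation.neg_neg (τ.ofPrec h)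
  rw [hneg] at hpz₂'
  -- The loop `p ≤ z₁ ≤ x ≤ z₂ ≤ p` for `g'`; that `z₁ ≠ p` is enough for the contradiction.
  exact hz₁ (hpz₁.antisymm hc (((hzx₁.of_prec h).trans (hzx₂'.of_prec h)).trans hpz₂')).symm
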